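/- Let $G$ be a finite (discrete) alphabet and let $\mathfrak{G}\subseteq G^{\mathbb{Z}}$ be a nonempty topological Markov chain, i.e. a closed shift-invariant set such that for every allowed word $g_1\cdots g_k$ ($k\ge 1$) the set of letters $h$ for which $g_1\cdots g_k h$ is allowed depends only on $g_k$; let $\sigma$ denote the shift map. Let $(\mathfrak{G},\Phi)$ be a cellular automaton of radius $1$, i.e. $\Phi:\mathfrak{G}\to\mathfrak{G}$ with $(\Phi(x))_i=\phi(x_i,x_{i+1})$ for a local rule $\phi:G\times G\to G$. Assume that it is structurally compatible, i.e. $(\phi(x_i,y_i))_{i\in\mathbb{Z}}\in\mathfrak{G}$ for all $x,y\in\mathfrak{G}$, and bipermutative, i.e. for every letter $w$ occurring in $\mathfrak{G}$ the maps $g\mapsto\phi(w,g)$ and $g\mapsto\phi(g,w)$ are permutations of $G$. Then there exist a finite topological Markov chain $\mathbb{F}$ over a finite alphabet (finite meaning that $\mathbb{F}$ has finitely many points), a full shift $\Sigma_n=\{0,\dots,n-1\}^{\mathbb{Z}}$, a quasigroup operation $\otimes$ on $\mathfrak{H}=\mathbb{F}\times\Sigma_n$ (all left and right translations are bijective) which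 is $k$-block for some $k\ge1$ (i.e. $(x\otimes y)_j$ is a fixed function of $x_j,\dots,x_{j+k-1}$ and $y_j,\dots,y_{j+k-1}$, for every $j\in\mathbb{Z}$), and a homeomorphism $\varphi:\mathfrak{G}\to\mathfrak{H}$, such that: (i) $\varphi$ is a $1$-block code, and $\varphi\circ\Phi=\Phi_{\mathfrak{H}}\circ\varphi$, where $\Phi_{\mathfrak{H}}(z)=z\otimes\sigma_{\mathfrak{H}}(z)$ for $z\in\mathfrak{H}$ and $\sigma_{\mathfrak{H}}$ is the shift map of $\mathfrak{H}$; (ii) the topological entropy of $\sigma$ on $\mathfrak{G}$ is zero if and only if $\Sigma_n$ consists of a single constant sequence; (iii) $\mathfrak{G}$ is irreducible (any two letters $u,w$ occurring in $\mathfrak{G}$ are joined by an allowed word $u v_1\cdots v_k w$ with $k\ge1$) and contains a constant sequence if and only if $\mathbb{F}$ is a singleton. -/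

import Mathlib

/-!
Two-sided subshifts over `ℤ` are Mathlib's `SymbolicDynamics.FullShift.Subshift A ℤ`, the shift map
is `SymbolicDynamics.FullShift.shift (1 : ℤ)`, with `(shift 1 x) i = x (1 + i)`, and the full shift
is `SymbolicDynamics.FullShift.fullShift`.
-/

namespace SymbolicCA

open SymbolicDynamics.FullShift

section Subshifts

variable {A B : Type*} [TopologicalSpace A] [TopologicalSpace B]

/-- The set of allowed words of length `k` of a subshift. -/
def words (X : Subshift A ℤ) (k : ℕ) : Set (Fin k → A) :=
  {w | ∃ x ∈ X.carrier, ∃ j : ℤ, ∀ i : Fin k, w i = x (j + ((i : ℕ) : ℤ))}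

/-- The letters that occur in a subshift (the allowed words of length one). -/
def letters (X : Subshift A ℤ) : Set A :=
  {a | (fun _ : Fin 1 => a) ∈ words X 1}

/-- The follower set of a word `w`: the letters `h` such that `w h` is an allowed word. -/
def followers (X : Subshift A ℤ) {k : ℕ} (w : Fin k → A) : Set A :=
  {h | (Fin.snoc w h : Fin (k + 1) → A) ∈ words X (k + 1)}

/-- Topological Markov chain: the follower set of an allowed nonempty word depends only on its
last letter. -/
def IsTopologicalMarkovChain (X : Subshift A ℤ) : Prop :=
  ∀ (k : ℕ), ∀ w ∈ words X (k + 1),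
    followers X w = followers X (fun _ : Fin 1 => w (Fin.last k))

/-- Irreducibility: any two letters `u`, `w` of the subshift are joined by an allowed word `u v w`
with `v` an allowed word of length at least one. -/
def IsIrreducible (X : Subshift A ℤ) : Prop :=
  ∀ u ∈ letters X, ∀ w ∈ letters X, ∃ k : ℕ, 1 ≤ k ∧ ∃ v ∈ words X k,
    (Fin.snoc (Fin.cons u v : Fin (k + 1) → A) w : Fin (k + 2) → A) ∈ words X (k + 2)

/-- The subshift contains a constant sequence. -/
def HasConstantSequence (X : Subshift A ℤ) : Prop :=
  ∃ a : A, (fun _ : ℤ => a) ∈ X.carrier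

/-- The shift map of a subshift, as a self-map. -/
def shiftMap (X : Subshift A ℤ) : X.carrier → X.carrier :=
  (X.mapsTo 1).restrict

/-- The product of two subshifts, as a subshift on the product alphabet. -/
def prodSubshift (X : Subshift A ℤ) (Y : Subshift B ℤ) : Subshift (A × B) ℤ where
  carrier := {z | (fun i => (z i).1) ∈ X.carrier ∧ (fun i => (z i).2) ∈ Y.carrier}
  isClosed := by
    have h1 : Continuous fun (z : ℤ → A × B) (i : ℤ) => (z i).1 := by fun_prop
    have h2 : Continuous fun (z : ℤ → A × B) (i : ℤ) => (z i).2 := by fun_prop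
    exact (X.isClosed.preimage h1).inter (Y.isClosed.preimage h2)
  mapsTo := fun g _ hz => ⟨X.mapsTo g hz.1, Y.mapsTo g hz.2⟩

/-- The window `x_{j-ℓ}, …, x_{j+r}` of a sequence. -/
def window (x : ℤ → A) (ℓ r : ℕ) (j : ℤ) : Fin (ℓ + r + 1) → A :=
  fun i => x (j - (ℓ : ℤ) + ((i : ℕ) : ℤ))

/-- `Θ` is an `(ℓ+r+1)`-block code with memory `ℓ` and anticipation `r`. -/
def IsBlockCode (X : Subshift A ℤ) (Y : Subshift B ℤ) (ℓ r : ℕ)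
    (Θ : X.carrier → Y.carrier) : Prop :=
  ∃ θ : (Fin (ℓ + r + 1) → A) → B, ∀ (x : X.carrier) (j : ℤ),
    (Θ x : ℤ → B) j = θ (window (x : ℤ → A) ℓ r j)

/-- `op` is an `(ℓ+r+1)`-block binary operation with memory `ℓ` and anticipation `r`. -/
def IsBlockOperation (X : Subshift A ℤ) (ℓ r : ℕ)
    (op : X.carrier → X.carrier → X.carrier) : Prop :=
  ∃ ρ : (Fin (ℓ + r + 1) → A) → (Fin (ℓ + r + 1) → A) → A, ∀ (x y : X.carrier) (j : ℤ),
    (op x y : ℤ → A) j = ρ (window (x : ℤ → A) ℓ r j) (window (y : ℤ → A) ℓ r j)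

end Subshifts

/-- A quasigroup operation: all left and right translations are bijective. -/
def IsQuasigroupOperation {S : Type*} (op : S → S → S) : Prop :=
  (∀ a, Function.Bijective fun b => op a b) ∧ (∀ b, Function.Bijective fun a => op a b)

/-- A cellular automaton of radius one on a subshift: a self-map of the subshift given by
`(Φ x) i = φ (x i) (x (i + 1))`, together with its local rule `φ`, defined on all pairs of letters
of the alphabet. -/
structure CellularAutomaton {G : Type*} [TopologicalSpace G] (X : Subshift G ℤ) where
  /-- The local rule. -/
  rule : G → G → G
  /-- The global map. -/
  toFun : X.carrier → X.carrier
  /-- The global map is given by the local rule. -/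
  toFun_apply : ∀ (x : X.carrier) (i : ℤ),
    (toFun x : ℤ → G) i = rule ((x : ℤ → G) i) ((x : ℤ → G) (i + 1))

namespace CellularAutomaton

variable {G : Type*} [TopologicalSpace G] {X : Subshift G ℤ}

/-- Right permutativity. -/
def RightPermutative (Φ : CellularAutomaton X) : Prop :=
  ∀ w ∈ letters X, Function.Bijective fun g : G => Φ.rule w g

/-- Left permutativity. -/
def LeftPermutative (Φ : CellularAutomaton X) : Prop :=
  ∀ w ∈ letters X, Function.Bijective fun g : G => Φ.rule g w

/-- Bipermutativity. -/
def Bipermutative (Φ : CellularAutomaton X) : Prop :=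
  Φ.LeftPermutative ∧ Φ.RightPermutative

/-- Structural compatibility: applying the local rule componentwise to two points of the subshift
gives a point of the subshift. -/
def StructurallyCompatible (Φ : CellularAutomaton X) : Prop :=
  ∀ x ∈ X.carrier, ∀ y ∈ X.carrier, (fun i : ℤ => Φ.rule (x i) (y i)) ∈ X.carrier

end CellularAutomaton

/-- Topological entropy of the shift map on a subshift. -/
noncomputable def shiftEntropy {A : Type*} [UniformSpace A] (X : Subshift A ℤ) : EReal :=
  Dynamics.coverEntropy (shift (1 : ℤ) : (ℤ → A) → (ℤ → A)) X.carrier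

end SymbolicCA

namespace SymbolicCA

open Function

/-! On the letters that occur, the local rule is a finite quasigroup operation preserving the
transition relation `E`, and counting makes `E` closed under division as well
(`IsCompatible.edge_of_op_left`). Hence follower sets that meet coincide
(`IsCompatible.edge_of_edges`), and "same predecessors" is a congruence whose quotient is again a
compatible graph.

Passing to this quotient loses only a free choice. Letters with the same predecessors and the same
successors are interchangeable in a path, and they form classes of constant size; labelling each
class uniformly splits off a full shift at the price of one further symbol of anticipation
(`IsCompatible.isProductCoding_of_quotient`). Iterating, the alphabet shrinks until "same
predecessors" is equality. Then `E` is the graph of a permutation and there are finitely many paths,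
which give 𝔽. The accumulated labels give the full shift.

The coding is letter-to-letter with a block inverse, so the operation on 𝔊 transports to a block
quasigroup operation. Entropy, irreducibility and constant sequences are read off from the two
factors. -/

/-- The bi-infinite paths of a directed graph. -/
def vertexShift {L : Type*} (E : L → L → Prop) : Set (ℤ → L) :=
  {x | ∀ i, E (x i) (x (i + 1))}

/-- A cancellative operation on the vertices of a directed graph without sources and sinks that
preserves the edges. -/
structure IsCompatible {L : Type*} (op : L → L → L) (E : L → L → Prop) : Prop where
  left_injective : ∀ a, Injective fun b => op a b
  right_injective : ∀ b, Injective fun a => op a b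
  map_edge : ∀ {a h b k}, E a h → E b k → E (op a b) (op h k)
  exists_succ : ∀ a, ∃ h, E a h
  exists_pred : ∀ h, ∃ a, E a h

/-- A letter-to-letter coding `(b, c)` of a set of bi-infinite sequences, with inverse of memory zero,
onto the product of a shift in which the zeroth letter determines the point with a full shift. -/
structure IsProductCoding {L : Type*} (S : Set (ℤ → L)) {m n : ℕ} (b : L → Fin m)
    (c : L → Fin n) : Prop where
  exists_lift : ∀ x ∈ S, ∀ s : ℤ → Fin n,
    ∃ y ∈ S, (∀ i, b (y i) = b (x i)) ∧ ∀ i, c (y i) = s i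
  exists_anticipation : ∃ r : ℕ, ∀ x ∈ S, ∀ y ∈ S,
    (∀ i : ℕ, i ≤ r → b (x i) = b (y i) ∧ c (x i) = c (y i)) → x 0 = y 0
  eq_of_zero : ∀ x ∈ S, ∀ y ∈ S, b (x 0) = b (y 0) →
    ∀ i, b (x i) = b (y i)

/-! ### Quasigroup operations compatible with a finite graph -/

section Compatible

variable {L : Type*} {op : L → L → L} {E : L → L → Prop}

theorem IsCompatible.reverse (h : IsCompatible op E) : IsCompatible op (flip E) where
  left_injective := h.left_injective
  right_injective := h.right_injective
  map_edge h1 h2 := h.map_edge h1 h2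
  exists_succ := h.exists_pred
  exists_pred := h.exists_succ

theorem IsCompatible.swap (h : IsCompatible op E) : IsCompatible (fun a b => op b a) E where
  left_injective := h.right_injective
  right_injective := h.left_injective
  map_edge h1 h2 := h.map_edge h2 h1
  exists_succ := h.exists_succ
  exists_pred := h.exists_pred

/-- Multiplication by a fixed edge is an injective self-map of the finite edge set, hence onto; left
cancellation identifies the preimage. -/
theorem IsCompatible.edge_of_op_left [Finite L] (hE : IsCompatible op E) {a b h k : L}
    (h1 : E a h) (h2 : E (op a b) (op h k)) : E b k := by
  let f : {p : L × L // E p.1 p.2} → {p : L × L // E p.1 p.2} := fun q =>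
    ⟨(op a q.1.1, op h q.1.2), hE.map_edge h1 q.2⟩
  have hf : Injective f := fun q q' hq => Subtype.ext <| Prod.ext
    (hE.left_injective _ (congrArg (fun t => t.1.1) hq))
    (hE.left_injective _ (congrArg (fun t => t.1.2) hq))
  obtain ⟨⟨⟨u, v⟩, huv⟩, hq⟩ := Finite.surjective_of_injective hf ⟨(op a b, op h k), h2⟩
  have hu : u = b := hE.left_injective a (congrArg (fun t => t.1.1) hq)
  have hv : v = k := hE.left_injective h (congrArg (fun t => t.1.2) hq)
  exact hu ▸ hv ▸ huv

theorem IsCompatible.edge_of_op_right [Finite L] (hE : IsCompatible op E) {a b h k : L}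
    (h1 : E b k) (h2 : E (op a b) (op h k)) : E a h :=
  hE.swap.edge_of_op_left h1 h2

/-- Two follower sets that meet are equal. -/
theorem IsCompatible.edge_of_edges [Finite L] (hE : IsCompatible op E) {a b h k : L}
    (hah : E a h) (hbh : E b h) (hak : E a k) : E b k := by
  -- The letters are chosen so that `b → k` is the product of the edges `v → h` and `u → w`. Both
  -- factors, and the auxiliary edge `u → u'`, come from the given edges by division.
  obtain ⟨u, hu⟩ := Finite.surjective_of_injective (hE.left_injective a) a
  obtain ⟨u', hu'⟩ := Finite.surjective_of_injective (hE.left_injective h) h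
  obtain ⟨v, hv⟩ := Finite.surjective_of_injective (hE.right_injective u) b
  obtain ⟨w, hw⟩ := Finite.surjective_of_injective (hE.left_injective h) k
  dsimp only at hu hu' hv hw
  have h1 : E u u' := hE.edge_of_op_left hah (by rwa [hu, hu'])
  have h2 : E v h := hE.edge_of_op_right h1 (by rwa [hv, hu'])
  have h3 : E u w := hE.edge_of_op_left hah (by rwa [hu, hw])
  have h4 := hE.map_edge h2 h3
  rwa [hv, hw] at h4

variable (E) in
/-- Vertices with the same predecessors. -/
def predSetoid : Setoid L where
  r h k := ∀ a, E a h ↔ E a k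
  iseqv := ⟨fun _ _ => Iff.rfl, fun h a => (h a).symm, fun h k a => (h a).trans (k a)⟩

theorem IsCompatible.pred_of_common [Finite L] (hE : IsCompatible op E) {a h k : L}
    (h1 : E a h) (h2 : E a k) : predSetoid E h k :=
  fun _ => ⟨fun h3 => hE.edge_of_edges h1 h3 h2, fun h3 => hE.edge_of_edges h2 h3 h1⟩

/-- The product of predecessors of `h` and `h'` is a common predecessor of both products, and a
common predecessor suffices. -/
theorem IsCompatible.pred_op [Finite L] (hE : IsCompatible op E) {h k h' k' : L}
    (h1 : predSetoid E h k) (h2 : predSetoid E h' k') :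
    predSetoid E (op h h') (op k k') := by
  obtain ⟨a, ha⟩ := hE.exists_pred h
  obtain ⟨a', ha'⟩ := hE.exists_pred h'
  exact hE.pred_of_common (hE.map_edge ha ha') (hE.map_edge ((h1 a).1 ha) ((h2 a').1 ha'))

theorem IsCompatible.exists_quotient [Finite L] (hE : IsCompatible op E) :
    ∃ op' : Quotient (predSetoid E) → Quotient (predSetoid E) → Quotient (predSetoid E),
      IsCompatible op' (Relation.Map E (Quotient.mk _) (Quotient.mk _)) := by
  -- Surjectivity of translations descends to the quotient; finiteness turns it back into
  -- injectivity.
  refine ⟨Quotient.map₂ op fun _ _ h _ _ h' => hE.pred_op h h', ?_, ?_, ?_, ?_, ?_⟩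
  · refine fun a => Finite.injective_iff_surjective.2 ?_
    induction a using Quotient.inductionOn with | _ a
    intro b
    induction b using Quotient.inductionOn with | _ b
    obtain ⟨c, hc⟩ := Finite.surjective_of_injective (hE.left_injective a) b
    exact ⟨⟦c⟧, congrArg (Quotient.mk _) hc⟩
  · refine fun a => Finite.injective_iff_surjective.2 ?_
    induction a using Quotient.inductionOn with | _ a
    intro b
    induction b using Quotient.inductionOn with | _ b
    obtain ⟨c, hc⟩ := Finite.surjective_of_injective (hE.right_injective a) b
    exact ⟨⟦c⟧, congrArg (Quotient.mk _) hc⟩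
  · rintro _ _ _ _ ⟨a, h, h1, rfl, rfl⟩ ⟨b, k, h2, rfl, rfl⟩
    exact ⟨_, _, hE.map_edge h1 h2, rfl, rfl⟩
  · intro a
    induction a using Quotient.inductionOn with | _ a
    obtain ⟨h, hh⟩ := hE.exists_succ a
    exact ⟨⟦h⟧, a, h, hh, rfl, rfl⟩
  · intro a
    induction a using Quotient.inductionOn with | _ a
    obtain ⟨h, hh⟩ := hE.exists_pred a
    exact ⟨⟦h⟧, h, a, hh, rfl, rfl⟩

/-- The classes of a congruence of a finite quasigroup can be labelled uniformly. -/
theorem exists_uniform_labelling [Finite L] (hl : ∀ a, Injective fun b => op a b)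
    (hr : ∀ b, Injective fun a => op a b) (s : Setoid L)
    (hs : ∀ {a a' b b'}, s a a' → s b b' → s (op a b) (op a' b')) :
    ∃ (n : ℕ) (c : L → Fin n), (∀ a i, ∃ b, s b a ∧ c b = i) ∧
      ∀ a b, s a b → c a = c b → a = b := by
  rcases isEmpty_or_nonempty L with hL | ⟨⟨z⟩⟩
  · exact ⟨0, hL.elim, fun a => hL.elim a, fun a => hL.elim a⟩
  let fib : Quotient s → Type _ := fun q => {a : L // (⟦a⟧ : Quotient s) = q}
  -- A left translation taking `a` to `b` injects the class of `a` into that of `b`; by symmetry all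
  -- classes have the same size.
  have hle : ∀ q q', Nat.card (fib q) ≤ Nat.card (fib q') := by
    intro q q'
    induction q using Quotient.inductionOn with | _ a
    induction q' using Quotient.inductionOn with | _ b
    obtain ⟨t, ht⟩ := Finite.surjective_of_injective (hr a) b
    let f : fib ⟦a⟧ → fib ⟦b⟧ := fun x => ⟨op t x.1, by
      have h1 : s x.1 a := Quotient.exact x.2
      have h2 := hs (s.refl t) h1
      change op t a = b at ht
      rw [ht] at h2
      exact Quotient.sound h2⟩
    exact Nat.card_le_card_of_injective f fun x y hxy =>
      Subtype.ext (hl t (congrArg Subtype.val hxy))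
  have e : ∀ q, fib q ≃ Fin (Nat.card (fib ⟦z⟧)) := fun q =>
    Finite.equivFinOfCardEq ((hle _ _).antisymm (hle _ _))
  refine ⟨_, fun a => e ⟦a⟧ ⟨a, rfl⟩, fun a i => ?_, fun a b hab h => ?_⟩
  · let x := (e ⟦a⟧).symm i
    -- The type of `e q` depends on `q`, so labels taken in equal classes are compared by
    -- eliminating the equality of classes.
    have key : ∀ (q : Quotient s) (hq : (⟦x.1⟧ : Quotient s) = q),
        e ⟦x.1⟧ ⟨x.1, rfl⟩ = e q ⟨x.1, hq⟩ := by
      rintro _ rfl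
      rfl
    refine ⟨x.1, Quotient.exact x.2, ?_⟩
    exact (key _ x.2).trans ((e ⟦a⟧).apply_symm_apply i)
  · have key : ∀ (q : Quotient s) (hq : (⟦a⟧ : Quotient s) = q),
        e ⟦a⟧ ⟨a, rfl⟩ = e q ⟨a, hq⟩ := by
      rintro _ rfl
      rfl
    have := (key _ (Quotient.sound hab)).symm.trans h
    exact congrArg Subtype.val ((e ⟦b⟧).injective this)

theorem shift_mem_vertexShift {x : ℤ → L} (hx : x ∈ vertexShift E) (j : ℤ) :
    (fun i => x (j + i)) ∈ vertexShift E := fun i => by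
  have := hx (j + i)
  rwa [add_assoc] at this

/-- Base case: successors of one vertex have the same predecessors, so here they are unique. The
successor map is onto, hence a permutation, and one letter determines the whole path; the full shift
is trivial. -/
theorem IsCompatible.isProductCoding_of_deterministic [Finite L] (hE : IsCompatible op E)
    (h : ∀ a b, predSetoid E a b → a = b) :
    ∃ (m n : ℕ) (b : L → Fin m) (c : L → Fin n), IsProductCoding (vertexShift E) b c := by
  have hdet : ∀ a h k, E a h → E a k → h = k := fun a b c h1 h2 => h _ _ (hE.pred_of_common h1 h2)
  choose f hf using hE.exists_succ
  have hfs : Surjective f := fun k => by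
    obtain ⟨a, ha⟩ := hE.exists_pred k
    exact ⟨a, hdet a _ _ (hf a) ha⟩
  have hfi : Injective f := Finite.injective_iff_surjective.2 hfs
  refine ⟨_, 1, Finite.equivFin L, fun _ => 0, ?_, ⟨0, ?_⟩, ?_⟩
  · exact fun x hx s => ⟨x, hx, fun _ => rfl, fun _ => Subsingleton.elim _ _⟩
  · intro x _ y _ hxy
    simpa using (hxy 0 le_rfl).1
  · intro x hx y hy hxy i
    have hstep : ∀ z ∈ vertexShift E, ∀ j, z (j + 1) = f (z j) := fun z hz j =>
      hdet _ _ _ (hz j) (hf _)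
    have h0 : x 0 = y 0 := by simpa using hxy
    suffices x i = y i by rw [this]
    induction i using Int.induction_on with
    | zero => exact h0
    | succ j ih => rw [hstep x hx, hstep y hy, ih]
    | pred j ih =>
      apply hfi
      rw [← hstep x hx, ← hstep y hy]
      simpa using ih

theorem IsCompatible.isProductCoding_of_quotient [Finite L] (hE : IsCompatible op E) {m n : ℕ}
    {b : Quotient (predSetoid E) → Fin m} {c : Quotient (predSetoid E) → Fin n}
    (h : IsProductCoding
      (vertexShift (Relation.Map E (Quotient.mk (predSetoid E)) (Quotient.mk _))) b c) :
    ∃ (m n : ℕ) (b : L → Fin m) (c : L → Fin n), IsProductCoding (vertexShift E) b c := by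
  -- Equal predecessors alone would not permit replacing a letter inside a path; the outgoing edges
  -- must be preserved too.
  let S : Setoid L := predSetoid E ⊓ predSetoid (flip E)
  obtain ⟨r, d, hd1, hd2⟩ := exists_uniform_labelling (op := op) hE.left_injective
    hE.right_injective S (fun h1 h2 => ⟨hE.pred_op h1.1 h2.1, hE.reverse.pred_op h1.2 h2.2⟩)
  have hproj : ∀ x ∈ vertexShift E, (fun i => (⟦x i⟧ : Quotient (predSetoid E))) ∈
      vertexShift (Relation.Map E (Quotient.mk (predSetoid E)) (Quotient.mk _)) :=
    fun x hx i => ⟨_, _, hx i, rfl, rfl⟩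
  refine ⟨m, n * r, fun a => b ⟦a⟧, fun a => finProdFinEquiv (c ⟦a⟧, d a), ?_, ?_, ?_⟩
  · intro x hx s
    obtain ⟨y, hy, hy1, hy2⟩ := h.exists_lift _ (hproj x hx) fun i => (finProdFinEquiv.symm (s i)).1
    choose p q hpq hp hq using hy
    choose t ht1 ht2 using fun i => hd1 (p i) (finProdFinEquiv.symm (s i)).2
    have hty : ∀ i, (⟦t i⟧ : Quotient (predSetoid E)) = y i := fun i =>
      (Quotient.sound (ht1 i).1).trans (hp i)
    -- The edge `p i → q i` moves to `p i → t (i + 1)` by equal predecessors, then to `t i → t (i +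
    -- 1)` by equal successors.
    refine ⟨t, fun i => ?_, fun i => ?_, fun i => ?_⟩
    · have h1 : predSetoid E (q i) (t (i + 1)) :=
        Quotient.exact ((hq i).trans (hty (i + 1)).symm)
      have h2 : E (p i) (t (i + 1)) := (h1 _).1 (hpq i)
      exact ((ht1 i).2 _).2 h2
    · rw [hty, hy1]
    · rw [hty, hy2, ht2]
      exact finProdFinEquiv.apply_symm_apply (s i)
  · obtain ⟨R, hR⟩ := h.exists_anticipation
    -- The extra symbol reveals the class at position 1. It gives `x 0` and `y 0` a common
    -- successor, hence the same successors, so the label `d` separates them.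
    refine ⟨R + 1, fun x hx y hy hxy => ?_⟩
    have h0 : predSetoid E (x 0) (y 0) := by
      refine Quotient.exact (hR _ (hproj x hx) _ (hproj y hy) fun i hi => ?_)
      obtain ⟨h1, h2⟩ := hxy i (by omega)
      exact ⟨h1, (Prod.ext_iff.1 (finProdFinEquiv.injective h2)).1⟩
    have h1 : predSetoid E (x 1) (y 1) := by
      refine Quotient.exact (hR _ (shift_mem_vertexShift (hproj x hx) 1) _
        (shift_mem_vertexShift (hproj y hy) 1) fun i hi => ?_)
      obtain ⟨h1, h2⟩ := hxy (i + 1) (by omega)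
      push_cast at h1 h2
      rw [add_comm (i : ℤ) 1] at h1 h2
      exact ⟨h1, (Prod.ext_iff.1 (finProdFinEquiv.injective h2)).1⟩
    have h2 : predSetoid (flip E) (x 0) (y 0) :=
      hE.reverse.pred_of_common (a := x 1) (hx 0) ((h1 _).2 (hy 0))
    refine hd2 _ _ ⟨h0, h2⟩ ?_
    exact (Prod.ext_iff.1 (finProdFinEquiv.injective (hxy 0 (by omega)).2)).2
  · exact fun x hx y hy hxy => h.eq_of_zero _ (hproj x hx) _ (hproj y hy) hxy

end Compatible

theorem IsCompatible.exists_isProductCoding {L : Type*} [Finite L] {op : L → L → L}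
    {E : L → L → Prop} (hE : IsCompatible op E) :
    ∃ (m n : ℕ) (b : L → Fin m) (c : L → Fin n), IsProductCoding (vertexShift E) b c := by
  induction hN : Nat.card L using Nat.strong_induction_on generalizing L with | _ N ih
  by_cases h : ∀ a b, predSetoid E a b → a = b
  · exact hE.isProductCoding_of_deterministic h
  · push Not at h
    obtain ⟨a, b, hab, hne⟩ := h
    obtain ⟨op', hE'⟩ := hE.exists_quotient
    have hlt : Nat.card (Quotient (predSetoid E)) < N := by
      have hs : Surjective (Quotient.mk (predSetoid E)) := Quotient.mk_surjective
      refine hN ▸ lt_of_le_of_ne (Nat.card_le_card_of_surjective _ hs) fun heq => hne ?_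
      exact (hs.bijective_of_nat_card_le heq.ge).1 (Quotient.sound hab)
    obtain ⟨m, n, b, c, hbc⟩ := ih _ hlt hE' rfl
    exact hE.isProductCoding_of_quotient hbc

open SymbolicDynamics.FullShift Filter Topology Uniformity

/-! ### Allowed words, Markov chains and irreducibility -/

section Words

variable {A : Type*} [TopologicalSpace A] {X : Subshift A ℤ}

theorem mem_letters {a : A} : a ∈ letters X ↔ ∃ x ∈ X.carrier, ∃ j : ℤ, x j = a := by
  constructor
  · rintro ⟨x, hx, j, h⟩
    exact ⟨x, hx, j, by simpa using (h 0).symm⟩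
  · rintro ⟨x, hx, j, rfl⟩
    exact ⟨x, hx, j, fun i => by simp [Subsingleton.elim i 0]⟩

theorem shift_mem_carrier {x : ℤ → A} (hx : x ∈ X.carrier) (j : ℤ) :
    (fun i => x (j + i)) ∈ X.carrier :=
  X.mapsTo j hx

/-- A point of a shift space is detected by its finite windows. -/
theorem mem_carrier_of_window {x : ℤ → A}
    (h : ∀ (k : ℕ) (j : ℤ), (fun i : Fin k => x (j + ((i : ℕ) : ℤ))) ∈ words X k) :
    x ∈ X.carrier := by
  have key : ∀ N : ℕ, ∃ y ∈ X.carrier, ∀ i : ℤ, -(N : ℤ) ≤ i → i ≤ N → y i = x i := by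
    intro N
    obtain ⟨y, hy, j, hj⟩ := h (2 * N + 1) (-N)
    refine ⟨_, shift_mem_carrier hy (j + N), fun i h1 h2 => ?_⟩
    have := hj ⟨(i + N).toNat, by omega⟩
    simp only [Int.toNat_of_nonneg (by omega : 0 ≤ i + N)] at this
    rw [show j + N + i = j + (i + N) by ring, ← this]
    congr 1
    ring
  choose y hy hyx using key
  refine X.isClosed.mem_of_tendsto (b := atTop) (f := y) ?_ (Eventually.of_forall hy)
  refine tendsto_pi_nhds.2 fun i => tendsto_const_nhds.congr' ?_
  filter_upwards [eventually_ge_atTop i.natAbs] with N hN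
  exact (hyx N i (by omega) (by omega)).symm

/-- A topological Markov chain contains every sequence of allowed transitions. -/
theorem IsTopologicalMarkovChain.mem_of_edges (hX : IsTopologicalMarkovChain X) {x : ℤ → A}
    (h : ∀ i, ∃ y ∈ X.carrier, ∃ j : ℤ, y j = x i ∧ y (j + 1) = x (i + 1)) : x ∈ X.carrier := by
  have key : ∀ (k : ℕ) (j : ℤ), (fun i : Fin (k + 1) => x (j + ((i : ℕ) : ℤ))) ∈ words X (k + 1) := by
    intro k j
    induction k with
    | zero =>
      obtain ⟨y, hy, l, h1, -⟩ := h j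
      exact ⟨y, hy, l, Fin.forall_fin_one.2 (by simpa using h1.symm)⟩
    | succ k ih =>
      have h1 : x (j + (k + 1 : ℕ)) ∈
          followers X (fun _ : Fin 1 => x (j + ((Fin.last k : ℕ) : ℤ))) := by
        obtain ⟨y, hy, l, h2, h3⟩ := h (j + k)
        refine ⟨y, hy, l, fun i => ?_⟩
        fin_cases i
        · simpa [Fin.snoc] using h2.symm
        · simpa [Fin.snoc, add_assoc] using h3.symm
      -- The Markov property turns a follower of the last letter into a follower of the whole word.
      rw [← hX k _ ih] at h1
      have h2 : (Fin.snoc (fun i : Fin (k + 1) => x (j + ((i : ℕ) : ℤ))) (x (j + (k + 1 : ℕ))) :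
          Fin (k + 2) → A) ∈ words X (k + 2) := h1
      convert h2 using 1
      ext i
      induction i using Fin.lastCases with
      | last => simp
      | cast i => simp
  refine mem_carrier_of_window fun k j => ?_
  obtain ⟨y, hy, l, hl⟩ := key k j
  exact ⟨y, hy, l, fun i => by simpa using hl i.castSucc⟩

theorem isIrreducible_iff : IsIrreducible X ↔ ∀ u ∈ letters X, ∀ w ∈ letters X,
    ∃ k : ℕ, 1 ≤ k ∧ ∃ x ∈ X.carrier, x 0 = u ∧ x (k + 1) = w := by
  refine forall₂_congr fun u _ => forall₂_congr fun w _ => exists_congr fun k =>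
    and_congr_right fun hk => ⟨?_, ?_⟩
  · rintro ⟨v, -, x, hx, j, h⟩
    refine ⟨_, shift_mem_carrier hx j, ?_, ?_⟩
    · have := h 0
      rw [← Fin.castSucc_zero, Fin.snoc_castSucc] at this
      simpa using this.symm
    · have := h (Fin.last _)
      simpa using this.symm
  · rintro ⟨x, hx, rfl, rfl⟩
    refine ⟨fun i => x (1 + ((i : ℕ) : ℤ)), ⟨x, hx, 1, fun _ => rfl⟩, x, hx, 0, fun i => ?_⟩
    induction i using Fin.lastCases with
    | last => simp
    | cast i =>
      rw [Fin.snoc_castSucc]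
      induction i using Fin.cases with
      | zero => simp
      | succ i => simp [add_comm]

end Words

/-! ### Entropy bounds -/

section Entropy

/-- A finite set covers itself at every scale and time, so covering numbers stay bounded. -/
theorem coverEntropy_eq_zero_of_finite {Y : Type*} [UniformSpace Y] (T : Y → Y) {F : Set Y}
    (hF : F.Finite) (hne : F.Nonempty) : Dynamics.coverEntropy T F = 0 := by
  refine le_antisymm (iSup₂_le fun U hU => ?_) (Dynamics.coverEntropy_nonneg T hne)
  have hcard : hF.toFinset.card ≠ 0 := by simpa using hne.ne_empty
  rw [← ExpGrowth.expGrowthSup_const (b := (hF.toFinset.card : ENNReal)) (by exact_mod_cast hcard)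
    (ENNReal.natCast_ne_top _)]
  refine ExpGrowth.expGrowthSup_monotone fun n => ?_
  have hcov : Dynamics.IsDynCoverOf T F U n (hF.toFinset : Set Y) := fun x hx =>
    ⟨x, by simpa using hx, Dynamics.mem_dynEntourage.2 fun k _ =>
      have := isRefl_of_mem_uniformity hU
      SetRel.refl U _⟩
  simpa using ENat.toENNReal_mono hcov.coverMincard_le_card

/-- A shift-space that maps letter-to-letter onto the full shift on `n` symbols has entropy at
least `log n`. -/
theorem log_le_coverEntropy_shift {A : Type*} [UniformSpace A] [DiscreteUniformity A]
    {S : Set (ℤ → A)} {n : ℕ} (hn : n ≠ 0) (c : A → Fin n)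
    (h : ∀ s : ℤ → Fin n, ∃ x ∈ S, ∀ i, c (x i) = s i) :
    ENNReal.log n ≤ Dynamics.coverEntropy (shift (1 : ℤ) : (ℤ → A) → (ℤ → A)) S := by
  have : NeZero n := ⟨hn⟩
  let U : SetRel (ℤ → A) (ℤ → A) := {p | p.1 0 = p.2 0}
  have hU : U ∈ 𝓤 (ℤ → A) :=
    Pi.uniformContinuous_proj (fun _ : ℤ => A) 0 (DiscreteUniformity.relId_mem_uniformity A)
  refine le_trans ?_ (Dynamics.netEntropyEntourage_le_coverEntropy _ S hU)
  rw [← ExpGrowth.expGrowthSup_pow]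
  refine ExpGrowth.expGrowthSup_monotone fun N => ?_
  choose p hpS hpc using h
  -- Only the coordinates `0, …, N - 1` matter; the values assigned elsewhere are arbitrary.
  let q : (Fin N → Fin n) → ℤ → A := fun w =>
    p fun i => if hi : i.toNat < N then w ⟨i.toNat, hi⟩ else 0
  have hq : ∀ w (i : Fin N), c (q w ((i : ℕ) : ℤ)) = w i := fun w i => by
    rw [hpc]
    simp
  have hiter : ∀ (k : ℕ) (x : ℤ → A), ((shift (1 : ℤ))^[k] x) 0 = x k := by
    intro k
    induction k with
    | zero => simp
    | succ k ih =>
      intro x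
      rw [iterate_succ_apply, ih, shift_apply]
      push_cast
      rw [add_comm]
  have hsep : ∀ w w', (∃ z, z ∈ UniformSpace.ball (q w) (Dynamics.dynEntourage (shift (1 : ℤ)) U N) ∧
      z ∈ UniformSpace.ball (q w') (Dynamics.dynEntourage (shift (1 : ℤ)) U N)) → w = w' := by
    rintro w w' ⟨z, h1, h2⟩
    ext1 i
    have h3 : q w i = z i := by
      have h5 : ((shift (1 : ℤ))^[(i : ℕ)] (q w)) 0 = ((shift (1 : ℤ))^[(i : ℕ)] z) 0 :=
        Dynamics.mem_dynEntourage.1 h1 i i.2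
      rwa [hiter, hiter] at h5
    have h4 : q w' i = z i := by
      have h5 : ((shift (1 : ℤ))^[(i : ℕ)] (q w')) 0 = ((shift (1 : ℤ))^[(i : ℕ)] z) 0 :=
        Dynamics.mem_dynEntourage.1 h2 i i.2
      rwa [hiter, hiter] at h5
    rw [← hq w i, ← hq w' i, h3, h4]
  have hqi : Injective q := fun w w' hw => by
    ext1 i
    rw [← hq w i, ← hq w' i, hw]
  classical
  have hnet : Dynamics.IsDynNetIn (shift (1 : ℤ)) S U N
      ((Finset.univ.image q : Finset (ℤ → A)) : Set (ℤ → A)) := by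
    refine ⟨fun x hx => ?_, fun x hx y hy hxy => ?_⟩
    · obtain ⟨w, -, rfl⟩ := Finset.mem_image.1 hx
      exact hpS _
    · obtain ⟨w, -, rfl⟩ := Finset.mem_image.1 hx
      obtain ⟨w', -, rfl⟩ := Finset.mem_image.1 hy
      refine Set.disjoint_left.2 fun z h1 h2 => hxy ?_
      rw [hsep w w' ⟨z, h1, h2⟩]
  have hc := ENat.toENNReal_mono hnet.card_le_netMaxcard
  rw [Finset.card_image_of_injective _ hqi] at hc
  simpa using hc

end Entropy

/-! ### The cellular automaton as a compatible operation on letters -/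

section Letters

variable {G : Type*} [TopologicalSpace G] {X : Subshift G ℤ}

/-- The transitions between letters that occur in a subshift. -/
def transition (X : Subshift G ℤ) (a h : letters X) : Prop :=
  ∃ x ∈ X.carrier, ∃ j : ℤ, x j = a ∧ x (j + 1) = h

/-- A point of a subshift as a sequence of its letters. -/
def toLetters (x : X.carrier) (i : ℤ) : letters X :=
  ⟨(x : ℤ → G) i, mem_letters.2 ⟨x, x.2, i, rfl⟩⟩

theorem toLetters_mem (x : X.carrier) : toLetters x ∈ vertexShift (transition X) :=
  fun i => ⟨x, x.2, i, rfl, rfl⟩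

theorem IsTopologicalMarkovChain.coe_mem (hX : IsTopologicalMarkovChain X) {y : ℤ → letters X}
    (hy : y ∈ vertexShift (transition X)) : (fun i => (y i : G)) ∈ X.carrier :=
  hX.mem_of_edges hy

namespace CellularAutomaton

variable {Φ : CellularAutomaton X}

theorem StructurallyCompatible.rule_mem (hSC : Φ.StructurallyCompatible) {a b : G}
    (ha : a ∈ letters X) (hb : b ∈ letters X) : Φ.rule a b ∈ letters X := by
  obtain ⟨x, hx, i, rfl⟩ := mem_letters.1 ha
  obtain ⟨y, hy, j, rfl⟩ := mem_letters.1 hb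
  exact mem_letters.2 ⟨_, hSC _ (shift_mem_carrier hx i) _ (shift_mem_carrier hy j), 0, by simp⟩

theorem StructurallyCompatible.isCompatible (hSC : Φ.StructurallyCompatible)
    (hbi : Φ.Bipermutative) :
    IsCompatible (fun a b : letters X => ⟨Φ.rule a b, hSC.rule_mem a.2 b.2⟩) (transition X) where
  left_injective a b b' h := Subtype.ext ((hbi.2 a a.2).1 (congrArg Subtype.val h))
  right_injective b a a' h := Subtype.ext ((hbi.1 b b.2).1 (congrArg Subtype.val h))
  map_edge := by
    rintro ⟨_, _⟩ ⟨_, _⟩ ⟨_, _⟩ ⟨_, _⟩ ⟨x, hx, i, rfl, rfl⟩ ⟨y, hy, j, rfl, rfl⟩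
    exact ⟨_, hSC _ (shift_mem_carrier hx i) _ (shift_mem_carrier hy j), 0, by simp, by simp⟩
  exists_succ a := by
    obtain ⟨x, hx, i, h⟩ := mem_letters.1 a.2
    exact ⟨⟨x (i + 1), mem_letters.2 ⟨x, hx, _, rfl⟩⟩, x, hx, i, h, rfl⟩
  exists_pred a := by
    obtain ⟨x, hx, i, h⟩ := mem_letters.1 a.2
    exact ⟨⟨x (i - 1), mem_letters.2 ⟨x, hx, _, rfl⟩⟩, x, hx, i - 1, rfl, by simpa using h⟩

/-- The operation induced on the subshift by the local rule. -/
def StructurallyCompatible.op (hSC : Φ.StructurallyCompatible) (x y : X.carrier) : X.carrier :=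
  ⟨fun i => Φ.rule ((x : ℤ → G) i) ((y : ℤ → G) i), hSC _ x.2 _ y.2⟩

/-- Division letter by letter stays in the subshift because transitions are closed under division.
-/
theorem StructurallyCompatible.isQuasigroupOperation [Finite G]
    (hSC : Φ.StructurallyCompatible)
    (hX : IsTopologicalMarkovChain X) (hbi : Φ.Bipermutative) :
    IsQuasigroupOperation hSC.op := by
  have hE := hSC.isCompatible hbi
  refine ⟨fun x => ⟨fun y y' h => ?_, fun z => ?_⟩, fun x => ⟨fun y y' h => ?_, fun z => ?_⟩⟩
  · ext i
    exact (hbi.2 _ (toLetters x i).2).1 (congrFun (congrArg Subtype.val h) i)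
  · choose y hy using fun i => Finite.surjective_of_injective
      (hE.left_injective (toLetters x i)) (toLetters z i)
    have hmem : y ∈ vertexShift (transition X) := fun i => by
      refine hE.edge_of_op_left (toLetters_mem x i) ?_
      have := toLetters_mem z i
      rwa [← hy i, ← hy (i + 1)] at this
    exact ⟨⟨_, hX.coe_mem hmem⟩, Subtype.ext (funext fun i => congrArg Subtype.val (hy i))⟩
  · ext i
    exact (hbi.1 _ (toLetters x i).2).1 (congrFun (congrArg Subtype.val h) i)
  · choose y hy using fun i => Finite.surjective_of_injective
      (hE.right_injective (toLetters x i)) (toLetters z i)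
    have hmem : y ∈ vertexShift (transition X) := fun i => by
      refine hE.edge_of_op_right (toLetters_mem x i) ?_
      have := toLetters_mem z i
      rwa [← hy i, ← hy (i + 1)] at this
    exact ⟨⟨_, hX.coe_mem hmem⟩, Subtype.ext (funext fun i => congrArg Subtype.val (hy i))⟩

theorem StructurallyCompatible.exists_isProductCoding [Finite G]
    (hSC : Φ.StructurallyCompatible)
    (hX : IsTopologicalMarkovChain X) (hbi : Φ.Bipermutative) (hne : X.carrier.Nonempty) :
    ∃ (m n : ℕ) (b : G → Fin m) (c : G → Fin n), IsProductCoding X.carrier b c := by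
  obtain ⟨m, n, b, c, h⟩ := (hSC.isCompatible hbi).exists_isProductCoding
  obtain ⟨x₀, hx₀⟩ := hne
  let l₀ := toLetters ⟨x₀, hx₀⟩ 0
  have hext : ∀ {k : ℕ} (f : letters X → Fin k) (x : X.carrier) (i : ℤ),
      extend Subtype.val f (fun _ => f l₀) ((x : ℤ → G) i) = f (toLetters x i) := fun f x i =>
    Subtype.val_injective.extend_apply f _ (toLetters x i)
  -- Letters that never occur receive the code of `l₀`, which has no effect on points of the
  -- subshift.
  refine ⟨m, n, extend Subtype.val b fun _ => b l₀, extend Subtype.val c fun _ => c l₀, ?_, ?_, ?_⟩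
  · intro x hx s
    obtain ⟨y, hy, h1, h2⟩ := h.exists_lift _ (toLetters_mem ⟨x, hx⟩) s
    refine ⟨_, hX.coe_mem hy, fun i => ?_, fun i => ?_⟩
    · exact (Subtype.val_injective.extend_apply _ _ _).trans
        ((h1 i).trans (hext b ⟨x, hx⟩ i).symm)
    · exact (Subtype.val_injective.extend_apply _ _ _).trans (h2 i)
  · obtain ⟨r, hr⟩ := h.exists_anticipation
    refine ⟨r, fun x hx y hy hxy => ?_⟩
    refine congrArg Subtype.val
      (hr _ (toLetters_mem ⟨x, hx⟩) _ (toLetters_mem ⟨y, hy⟩) fun i hi => ?_)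
    have := hxy i hi
    rwa [hext b ⟨x, hx⟩, hext b ⟨y, hy⟩, hext c ⟨x, hx⟩, hext c ⟨y, hy⟩] at this
  · intro x hx y hy hxy i
    rw [hext b ⟨x, hx⟩, hext b ⟨y, hy⟩] at hxy ⊢
    exact h.eq_of_zero _ (toLetters_mem ⟨x, hx⟩) _ (toLetters_mem ⟨y, hy⟩) hxy i

end CellularAutomaton

end Letters

/-! ### The coding homeomorphism and what it transports -/

namespace IsProductCoding

variable {G : Type*} [TopologicalSpace G] {X : Subshift G ℤ} {m n : ℕ} {b : G → Fin m}
  {c : G → Fin n}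

theorem exists_eq_of_codes_eq (h : IsProductCoding X.carrier b c) :
    ∃ r : ℕ, ∀ x ∈ X.carrier, ∀ y ∈ X.carrier, ∀ i j : ℤ, (∀ k : ℕ, k ≤ r →
      b (x (i + k)) = b (y (j + k)) ∧ c (x (i + k)) = c (y (j + k))) → x i = y j := by
  obtain ⟨r, hr⟩ := h.exists_anticipation
  refine ⟨r, fun x hx y hy i j hxy => ?_⟩
  simpa using hr _ (shift_mem_carrier hx i) _ (shift_mem_carrier hy j) hxy

theorem eq_of_eq (h : IsProductCoding X.carrier b c) {x y : ℤ → G} (hx : x ∈ X.carrier)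
    (hy : y ∈ X.carrier) {i j : ℤ} (hij : b (x i) = b (y j)) (k : ℤ) :
    b (x (i + k)) = b (y (j + k)) :=
  h.eq_of_zero _ (shift_mem_carrier hx i) _ (shift_mem_carrier hy j) (by simpa using hij) k

/-- The first factor of a product coding. -/
def factor (h : IsProductCoding X.carrier b c) : Subshift (Fin m) ℤ where
  carrier := {e | ∃ x ∈ X.carrier, ∀ i, e i = b (x i)}
  isClosed := by
    -- The zeroth letter determines the point, so the factor is finite and therefore closed.
    have hinj : Set.InjOn (fun e : ℤ → Fin m => e 0) {e | ∃ x ∈ X.carrier, ∀ i, e i = b (x i)} := by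
      rintro e ⟨x, hx, hex⟩ e' ⟨y, hy, hey⟩ he
      ext1 i
      dsimp only at he
      rw [hex, hey] at he ⊢
      exact h.eq_of_zero x hx y hy he i
    exact (Set.Finite.of_finite_image (Set.toFinite _) hinj).isClosed
  mapsTo := by
    rintro j e ⟨x, hx, hex⟩
    exact ⟨_, shift_mem_carrier hx j, fun i => hex _⟩

theorem eq_of_mem_factor (h : IsProductCoding X.carrier b c) {e e' : ℤ → Fin m}
    (he : e ∈ h.factor.carrier) (he' : e' ∈ h.factor.carrier) {i j : ℤ} (hij : e i = e' j)
    (k : ℤ) : e (i + k) = e' (j + k) := by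
  obtain ⟨x, hx, hex⟩ := he
  obtain ⟨y, hy, hey⟩ := he'
  rw [hex, hey] at hij ⊢
  exact h.eq_of_eq hx hy hij k

theorem finite_factor (h : IsProductCoding X.carrier b c) : h.factor.carrier.Finite := by
  refine Set.Finite.of_finite_image (f := fun e : ℤ → Fin m => e 0) (Set.toFinite _) ?_
  intro e he e' he' hee
  ext1 i
  simpa using h.eq_of_mem_factor he he' hee i

theorem isTopologicalMarkovChain_factor (h : IsProductCoding X.carrier b c) :
    IsTopologicalMarkovChain h.factor := by
  rintro k w ⟨e, he, j, hej⟩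
  ext a
  constructor
  · rintro ⟨e', he', j', hej'⟩
    refine ⟨e', he', j' + k, ?_⟩
    have h1 := hej' (Fin.last k).castSucc
    have h2 := hej' (Fin.last (k + 1))
    intro i
    fin_cases i
    · simpa [Fin.snoc] using h1
    · simpa [Fin.snoc, add_assoc] using h2
  · rintro ⟨e', he', j', hej'⟩
    refine ⟨e, he, j, fun i => ?_⟩
    induction i using Fin.lastCases with
    | cast i => simpa using hej i
    | last =>
      have h1 := hej' (0 : Fin 1).castSucc
      have h2 := hej' (Fin.last 1)
      rw [Fin.snoc_castSucc, hej] at h1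
      have h3 := h.eq_of_mem_factor he he' h1 1
      rw [Fin.snoc_last] at h2 ⊢
      rw [h2]
      simpa [add_assoc] using h3.symm

/-- The coding map. -/
def code (h : IsProductCoding X.carrier b c) (x : X.carrier) :
    (prodSubshift h.factor (fullShift (Fin n) ℤ)).carrier :=
  ⟨fun i => (b ((x : ℤ → G) i), c ((x : ℤ → G) i)), ⟨x, x.2, fun _ => rfl⟩, trivial⟩

theorem code_bijective (h : IsProductCoding X.carrier b c) : Bijective h.code := by
  constructor
  · intro x y hxy
    obtain ⟨r, hr⟩ := h.exists_eq_of_codes_eq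
    ext i
    refine hr _ x.2 _ y.2 i i fun k _ => Prod.mk.inj ?_
    exact congrFun (congrArg Subtype.val hxy) (i + k)
  · rintro ⟨z, ⟨x, hx, hxz⟩, -⟩
    obtain ⟨y, hy, h1, h2⟩ := h.exists_lift x hx fun i => (z i).2
    exact ⟨⟨y, hy⟩, Subtype.ext (funext fun i => Prod.ext ((h1 i).trans (hxz i).symm) (h2 i))⟩

theorem continuous_code [DiscreteTopology G] (h : IsProductCoding X.carrier b c) :
    Continuous h.code := by
  refine Continuous.subtype_mk (continuous_pi fun i => ?_) _
  exact (continuous_of_discreteTopology (f := fun g => (b g, c g))).comp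
    ((continuous_apply i).comp continuous_subtype_val)

/-- The coding map as a homeomorphism. -/
noncomputable def homeo [Finite G] [DiscreteTopology G] (h : IsProductCoding X.carrier b c) :
    X.carrier ≃ₜ (prodSubshift h.factor (fullShift (Fin n) ℤ)).carrier :=
  have : CompactSpace X.carrier := isCompact_iff_compactSpace.1 X.isClosed.isCompact
  Continuous.homeoOfEquivCompactToT2 (f := Equiv.ofBijective h.code h.code_bijective)
    h.continuous_code

theorem homeo_apply [Finite G] [DiscreteTopology G] (h : IsProductCoding X.carrier b c)
    (x : X.carrier) : h.homeo x = h.code x := rfl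

theorem isBlockCode_homeo [Finite G] [DiscreteTopology G] (h : IsProductCoding X.carrier b c) :
    IsBlockCode X _ 0 0 h.homeo :=
  ⟨fun w => (b (w 0), c (w 0)), fun x j => by simp [homeo_apply, code, window]⟩

/-- Letters with equal code windows agree even across points and positions, so one map `ψ` decodes
everywhere. -/
theorem exists_block_inverse [Nonempty G] (h : IsProductCoding X.carrier b c) :
    ∃ (r : ℕ) (ψ : (Fin (0 + r + 1) → Fin m × Fin n) → G), ∀ (x : X.carrier) (j : ℤ),
      (x : ℤ → G) j = ψ (window (h.code x : ℤ → Fin m × Fin n) 0 r j) := by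
  obtain ⟨r, hr⟩ := h.exists_eq_of_codes_eq
  let f : X.carrier × ℤ → (Fin (0 + r + 1) → Fin m × Fin n) := fun p => window (h.code p.1) 0 r p.2
  obtain ⟨ψ, hψ⟩ := (factorsThrough_iff (f := f) fun p : X.carrier × ℤ => (p.1 : ℤ → G) p.2).1 <| by
    rintro ⟨x, i⟩ ⟨y, j⟩ hxy
    refine hr _ x.2 _ y.2 i j fun k hk => Prod.mk.inj ?_
    simpa [f, window, code] using congrFun hxy ⟨k, by omega⟩
  exact ⟨r, ψ, fun x j => congrFun hψ (x, j)⟩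

theorem isBlockOperation [Finite G] [DiscreteTopology G] [Nonempty G]
    (h : IsProductCoding X.carrier b c) (op : X.carrier → X.carrier → X.carrier) (rule : G → G → G)
    (hop : ∀ x y i, (op x y : ℤ → G) i = rule ((x : ℤ → G) i) ((y : ℤ → G) i)) :
    ∃ k : ℕ, 1 ≤ k ∧ IsBlockOperation (prodSubshift h.factor (fullShift (Fin n) ℤ)) 0 (k - 1)
      fun z w => h.homeo (op (h.homeo.symm z) (h.homeo.symm w)) := by
  obtain ⟨r, ψ, hψ⟩ := h.exists_block_inverse
  refine ⟨r + 1, by omega, fun u v => (b (rule (ψ u) (ψ v)), c (rule (ψ u) (ψ v))), fun z w j => ?_⟩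
  obtain ⟨x, rfl⟩ := h.homeo.surjective z
  obtain ⟨y, rfl⟩ := h.homeo.surjective w
  simp only [Homeomorph.symm_apply_apply]
  change (b ((op x y : ℤ → G) j), c ((op x y : ℤ → G) j)) = _
  rw [hop, hψ x j, hψ y j]
  rfl

theorem shiftEntropy_eq_zero_iff {G : Type*} [UniformSpace G] [DiscreteUniformity G] [Finite G]
    {X : Subshift G ℤ} {b : G → Fin m} {c : G → Fin n} (h : IsProductCoding X.carrier b c)
    (hne : X.carrier.Nonempty) :
    shiftEntropy X = 0 ↔ ∃ a : Fin n, (fullShift (Fin n) ℤ).carrier = {fun _ => a} := by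
  obtain ⟨x, hx⟩ := hne
  have hn : 0 < n := (c (x 0)).pos
  constructor
  · intro h0
    have h1 := log_le_coverEntropy_shift hn.ne' c fun s => by
      obtain ⟨y, hy, -, h2⟩ := h.exists_lift x hx s
      exact ⟨y, hy, h2⟩
    rw [show Dynamics.coverEntropy _ _ = 0 from h0, ENNReal.log_le_zero_iff] at h1
    -- Entropy is at least `log n`, which forces `n ≤ 1`.
    obtain rfl : n = 1 := le_antisymm (by exact_mod_cast h1) hn
    exact ⟨0, Set.eq_singleton_iff_unique_mem.2 ⟨trivial, fun _ _ => Subsingleton.elim _ _⟩⟩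
  · rintro ⟨a, ha⟩
    have hc : ∀ i : Fin n, i = a := fun i => by
      have : (fun _ : ℤ => i) ∈ (fullShift (Fin n) ℤ).carrier := trivial
      rw [ha] at this
      exact congrFun this 0
    refine coverEntropy_eq_zero_of_finite _ ?_ ⟨x, hx⟩
    obtain ⟨r, hr⟩ := h.exists_eq_of_codes_eq
    refine Set.Finite.of_finite_image (f := fun y : ℤ → G => b (y 0)) (Set.toFinite _) ?_
    intro y hy z hz hyz
    ext1 i
    refine hr y hy z hz i i fun k _ => ⟨?_, (hc _).trans (hc _).symm⟩
    exact h.eq_of_zero y hy z hz hyz _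

theorem isIrreducible_and_hasConstantSequence_iff (h : IsProductCoding X.carrier b c)
    (hne : X.carrier.Nonempty) :
    (IsIrreducible X ∧ HasConstantSequence X) ↔ ∃ e : ℤ → Fin m, h.factor.carrier = {e} := by
  constructor
  · rintro ⟨hirr, a, ha⟩
    refine ⟨fun _ => b a, Set.eq_singleton_iff_unique_mem.2 ⟨⟨_, ha, fun _ => rfl⟩, ?_⟩⟩
    rintro e ⟨x, hx, hex⟩
    ext1 i
    obtain ⟨k, -, y, hy, hy0, hyk⟩ := isIrreducible_iff.1 hirr a (mem_letters.2 ⟨_, ha, 0, rfl⟩)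
      (x i) (mem_letters.2 ⟨x, hx, i, rfl⟩)
    -- A path joining `a` to `x i` has the same first code at time 0 as the constant point, hence at
    -- all times.
    rw [hex, ← hyk]
    exact h.eq_of_zero y hy _ ha (congrArg b hy0) _
  · rintro ⟨e, he⟩
    obtain ⟨r, hr⟩ := h.exists_eq_of_codes_eq
    have hb : ∀ x ∈ X.carrier, ∀ y ∈ X.carrier, ∀ i j, b (x i) = b (y j) := by
      intro x hx y hy i j
      have h1 : (fun k => b (x (i + k))) ∈ h.factor.carrier :=
        ⟨_, shift_mem_carrier hx i, fun _ => rfl⟩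
      have h2 : (fun k => b (y (j + k))) ∈ h.factor.carrier :=
        ⟨_, shift_mem_carrier hy j, fun _ => rfl⟩
      rw [he] at h1 h2
      simpa using congrFun (Eq.trans h1 (Eq.symm h2)) 0
    refine ⟨isIrreducible_iff.2 fun u hu w hw => ?_, ?_⟩
    · obtain ⟨x, hx, i, rfl⟩ := mem_letters.1 hu
      obtain ⟨y, hy, j, rfl⟩ := mem_letters.1 hw
      -- Coordinates `0, …, r` force `z 0 = x i`, and those from `r + 2` on force `z (r + 2) = y j`.
      -- The value at `r + 1` is filler.
      obtain ⟨z, hz, -, hzs⟩ := h.exists_lift x hx fun k =>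
        if k ≤ r then c (x (i + k)) else c (y (j + (k - (r + 2))))
      refine ⟨r + 1, by omega, z, hz, ?_, ?_⟩
      · refine hr z hz x hx 0 i fun k hk => ⟨hb _ hz _ hx _ _, ?_⟩
        rw [hzs, if_pos (by omega), zero_add]
      · refine hr z hz y hy _ j fun k hk => ⟨hb _ hz _ hy _ _, ?_⟩
        rw [hzs, if_neg (by push_cast; omega)]
        congr 3
        push_cast
        ring
    · obtain ⟨x, hx⟩ := hne
      -- Constant labels together with a constant first code make all code windows of `z` equal, so
      -- `z` is constant.
      obtain ⟨z, hz, -, hzs⟩ := h.exists_lift x hx fun _ => c (x 0)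
      refine ⟨z 0, ?_⟩
      convert hz using 1
      ext1 i
      exact hr z hz z hz 0 i fun k _ => ⟨hb _ hz _ hz _ _, by rw [hzs, hzs]⟩

end IsProductCoding

/-! ### Assembly of the main theorem -/

theorem IsQuasigroupOperation.conj {S T : Type*} {op : S → S → S} (h : IsQuasigroupOperation op)
    (e : S ≃ T) : IsQuasigroupOperation fun z w => e (op (e.symm z) (e.symm w)) :=
  ⟨fun z => e.bijective.comp ((h.1 (e.symm z)).comp e.symm.bijective),
    fun w => e.bijective.comp ((h.2 (e.symm w)).comp e.symm.bijective)⟩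

end SymbolicCA

theorem mainTheorem2 {G : Type*} [Finite G] [UniformSpace G] [DiscreteUniformity G]
    (X : SymbolicDynamics.FullShift.Subshift G ℤ) (hne : X.carrier.Nonempty)
    (hX : SymbolicCA.IsTopologicalMarkovChain X)
    (Φ : SymbolicCA.CellularAutomaton X)
    (hSC : Φ.StructurallyCompatible) (hbi : Φ.Bipermutative) :
    ∃ (m n : ℕ) (F : SymbolicDynamics.FullShift.Subshift (Fin m) ℤ)
      (H : SymbolicDynamics.FullShift.Subshift (Fin m × Fin n) ℤ)
      (op : H.carrier → H.carrier → H.carrier)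
      (φ : X.carrier ≃ₜ H.carrier),
      H = SymbolicCA.prodSubshift F (SymbolicDynamics.FullShift.fullShift (Fin n) ℤ) ∧
      F.carrier.Finite ∧ SymbolicCA.IsTopologicalMarkovChain F ∧
      SymbolicCA.IsQuasigroupOperation op ∧
      (∃ k : ℕ, 1 ≤ k ∧ SymbolicCA.IsBlockOperation H 0 (k - 1) op) ∧
      SymbolicCA.IsBlockCode X H 0 0 φ ∧
      (∀ x : X.carrier, φ (Φ.toFun x) = op (φ x) (SymbolicCA.shiftMap H (φ x))) ∧
      (SymbolicCA.shiftEntropy X = 0 ↔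
        ∃ a : Fin n,
          (SymbolicDynamics.FullShift.fullShift (Fin n) ℤ).carrier = {fun _ => a}) ∧
      ((SymbolicCA.IsIrreducible X ∧ SymbolicCA.HasConstantSequence X) ↔
        ∃ e : ℤ → Fin m, F.carrier = {e}) := by
  obtain ⟨m, n, b, c, h⟩ := hSC.exists_isProductCoding hX hbi hne
  have : Nonempty G := ⟨hne.some 0⟩
  refine ⟨m, n, h.factor, _, fun z w => h.homeo (hSC.op (h.homeo.symm z) (h.homeo.symm w)), h.homeo,
    rfl, h.finite_factor, h.isTopologicalMarkovChain_factor,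
    (hSC.isQuasigroupOperation hX hbi).conj h.homeo.toEquiv,
    h.isBlockOperation hSC.op Φ.rule fun _ _ _ => rfl, h.isBlockCode_homeo, fun x => ?_,
    h.shiftEntropy_eq_zero_iff hne, h.isIrreducible_and_hasConstantSequence_iff hne⟩
  -- The coding acts letter by letter, so it commutes with the shift definitionally; what remains is
  -- that `Φ x` is the product of `x` with its shift.
  have hshift : SymbolicCA.shiftMap _ (h.homeo x) = h.homeo (SymbolicCA.shiftMap X x) := rfl
  beta_reduce
  rw [hshift, Homeomorph.symm_apply_apply, Homeomorph.symm_apply_apply]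
  congr 1
  ext i
  rw [Φ.toFun_apply, add_comm]
  rfl
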